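/- **Definitions.** All vectors carry the Euclidean norm, matrices the induced operator (spectral) norm, and $\mathbb R_+=[0,\infty)$. Let $F:\mathbb R^{d}\to\mathbb R^{p}$ be locally Lipschitz. Its Clarke subdifferential at $x$ (the generalized Jacobian if $p>1$) is $$\partial F(x)=\operatorname{conv}\Big\{\lim_{k\to\infty} DF(x_k)\;:\;x_k\to x,\ F\text{ differentiable at }x_k,\ x_k\notin S\Big\},$$ where $S$ is any Lebesgue null set and only convergent sequences $DF(x_k)$ are considered (for $p=1$, $DF(x_k)$ is identified with the gradient $\nabla F(x_k)$). Let $\alpha:\mathbb R^{d}\to\mathbb R_+$ and $\beta:\mathbb R^{d}\times\mathbb R_+\to\mathbb R_+$ be functions. We say that $F$ satisfies the $(\alpha,\beta)$ subgradient growth condition if $F$, $\alpha$ and $\beta$ are continuous, $\beta(x,r)$ is non-decreasing in $r$, and $$\sup_{\zeta\in\partial F(x)}\|\zeta\|\le\alpha(x)\quad\text{for all }x,\qquad |\alpha(x)-\alpha(y)|\le\beta(x,\|y-x\|)\quad\text{for all }x,y .$$ **Proposition.** Let $g:\mathbb R^{m}\to\mathbb R$ and $h:\mathbb R^{d}\to\mathbb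 R^{m}$ be locally Lipschitz, and suppose that $g$ satisfies the $(\alpha_g,\beta_g)$ subgradient growth condition and $h$ satisfies the $(\alpha_h,\beta_h)$ subgradient growth condition. Then $f=g\circ h$ satisfies the $(\alpha_f,\beta_f)$ subgradient growth condition with $$\alpha_f(x)=\alpha_h(x)\,\alpha_g(h(x)),$$ $$\beta_f(x,r)=\big(\alpha_h(x)+\beta_h(x,r)\big)\,\beta_g\big(h(x),(\alpha_h(x)+\beta_h(x,r))\,r\big)+\beta_h(x,r)\,\alpha_g(h(x)).$$ This holds for every choice of the Lebesgue null sets $S_g,S_h,S_f$ used in the subdifferentials of $g$, $h$ and $f$. -/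

import Mathlib

open Filter Topology MeasureTheory
open scoped NNReal

/-- The Clarke subdifferential (for vector-valued maps: Clarke's generalized Jacobian) of `f` at
`x`: the convex hull of all limits of derivatives of `f` along sequences of points of
differentiability that converge to `x` and avoid the set `S`. The set `S` is meant to be a Lebesgue
null set.

Derivatives are continuous linear maps with the operator norm. For real-valued `f` the derivative
is the inner product with the gradient, and its operator norm is the Euclidean norm of the
gradient. -/
def clarkeSubdifferential {E F : Type*} [NormedAddCommGroup E] [NormedSpace ℝ E]
    [NormedAddCommGroup F] [NormedSpace ℝ F] (S : Set E) (f : E → F) (x : E) :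
    Set (E →L[ℝ] F) :=
  convexHull ℝ {L : E →L[ℝ] F | ∃ u : ℕ → E, Tendsto u atTop (𝓝 x) ∧
    (∀ k, u k ∉ S ∧ DifferentiableAt ℝ f (u k)) ∧
    Tendsto (fun k => fderiv ℝ f (u k)) atTop (𝓝 L)}

/-- The `(α, β)` subgradient growth condition for `f`, where the set `S` is avoided in the Clarke
subdifferential. -/
structure SubgradientGrowth {E F : Type*} [NormedAddCommGroup E] [NormedSpace ℝ E]
    [NormedAddCommGroup F] [NormedSpace ℝ F] (S : Set E) (f : E → F)
    (α : E → ℝ≥0) (β : E → ℝ≥0 → ℝ≥0) : Prop where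
  continuous_fun : Continuous f
  continuous_alpha : Continuous α
  continuous_beta : Continuous (fun p : E × ℝ≥0 => β p.1 p.2)
  monotone_beta : ∀ x, Monotone (β x)
  /-- The supremum of the norms of the subgradients at `x` is at most `α x`. -/
  norm_le : ∀ x, ∀ ζ ∈ clarkeSubdifferential S f x, ‖ζ‖ ≤ (α x : ℝ)
  abs_sub_le : ∀ x y, |(α x : ℝ) - (α y : ℝ)| ≤ (β x ‖y - x‖₊ : ℝ)

/-! The chain rule cannot be applied almost everywhere: `h` may send a set of positive measure into
the null set where `g` is not differentiable. Lipschitz constants replace it. The growth condition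
bounds the derivative by `α` almost everywhere, so on any ball where `α ≤ C` the map is
`C`-Lipschitz (`lipschitzOnWith_closedBall`). Such constants multiply under composition and bound
`fderiv` at every point, so the choice of null set for `g ∘ h` is irrelevant. The same lemma bounds
`‖h y - h x‖`, which feeds the argument of `β_g`. -/

section LipschitzOfDerivative

variable {E F : Type*} [NormedAddCommGroup E] [NormedSpace ℝ E] [FiniteDimensional ℝ E]
  [MeasurableSpace E] [BorelSpace E] [NormedAddCommGroup F] [NormedSpace ℝ F]
  [FiniteDimensional ℝ F]

/-- **Rademacher's theorem** for locally Lipschitz maps. -/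
theorem LocallyLipschitz.ae_differentiableAt_of_mem_ball {μ : Measure E} [μ.IsAddHaarMeasure]
    {f : E → F} (hf : LocallyLipschitz f) (x : E) (R : ℝ) :
    ∀ᵐ z ∂μ, z ∈ Metric.ball x R → DifferentiableAt ℝ f z := by
  obtain ⟨K, hK⟩ := hf.locallyLipschitzOn.exists_lipschitzOnWith_of_compact
    (isCompact_closedBall x R)
  filter_upwards [(hK.mono Metric.ball_subset_closedBall).ae_differentiableWithinAt_of_mem
    (μ := μ)] with z hz hzR
  exact (hz hzR).differentiableAt (Metric.isOpen_ball.mem_nhds hzR)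

/-- If the derivative of a locally Lipschitz map is bounded almost everywhere on a ball, then the
increments along a segment are bounded on average. -/
theorem LocallyLipschitz.norm_setIntegral_sub_le {μ : Measure E} [μ.IsAddHaarMeasure]
    {f : E → F} (hf : LocallyLipschitz f) {x : E} {R : ℝ} {C : ℝ≥0}
    (h : ∀ᵐ z ∂μ, z ∈ Metric.ball x R → ‖fderiv ℝ f z‖ ≤ C) {r ρ : ℝ} (hr : r + ρ ≤ R)
    {a b : E} (ha : a ∈ Metric.ball x r) (hb : b ∈ Metric.ball x r) :
    ‖∫ y in Metric.ball a ρ, (f (y + (b - a)) - f y) ∂μ‖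
      ≤ C * ‖b - a‖ * μ.real (Metric.ball a ρ) := by
  borelize F
  set v := b - a
  have hfc : Continuous f := hf.continuous
  obtain ⟨K, hK⟩ := hf.locallyLipschitzOn.exists_lipschitzOnWith_of_compact
    (isCompact_closedBall x R)
  have hint : ∀ t : ℝ, IntegrableOn (fun y => f (y + t • v)) (Metric.ball a ρ) μ := fun t =>
    ((by fun_prop : Continuous fun y => f (y + t • v)).continuousOn.integrableOn_compact
      (isCompact_closedBall a ρ)).mono_set Metric.ball_subset_closedBall
  have hmem : ∀ t : ℝ, a + t • v ∈ Metric.ball x r → ∀ y ∈ Metric.ball a ρ,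
      y + t • v ∈ Metric.ball x R := by
    intro t ht y hy
    rw [Metric.mem_ball] at *
    have := dist_triangle (y + t • v) (a + t • v) x
    rw [dist_add_right] at this
    linarith
  have hseg : ∀ t ∈ Set.Icc (0 : ℝ) 1, a + t • v ∈ Metric.ball x r := fun t ht =>
    (convex_ball x r).add_smul_sub_mem ha hb ht
  -- A single segment may lie inside the exceptional null set. Averaging over `y` avoids this: for
  -- each fixed `t`, translation by `t • v` preserves null sets.
  have hderiv : ∀ t ∈ Set.Icc (0 : ℝ) 1, HasDerivAt
      (fun t : ℝ => ∫ y in Metric.ball a ρ, f (y + t • v) ∂μ)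
      (∫ y in Metric.ball a ρ, fderiv ℝ f (y + t • v) v ∂μ) t := by
    intro t ht
    have hs : {s : ℝ | a + s • v ∈ Metric.ball x r} ∈ 𝓝 t :=
      (Metric.isOpen_ball.preimage (by fun_prop : Continuous fun s : ℝ => a + s • v)).mem_nhds
        (hseg t ht)
    refine (hasDerivAt_integral_of_dominated_loc_of_lip (bound := fun _ => (K : ℝ) * ‖v‖) hs
      (Eventually.of_forall fun s => (hint s).aestronglyMeasurable) (hint t) ?_ ?_ ?_ ?_).2
    · exact (((measurable_fderiv_apply_const ℝ f v).comp
        (measurable_add_const (t • v))).stronglyMeasurable).aestronglyMeasurable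
    · refine (ae_restrict_iff' measurableSet_ball).2 (Eventually.of_forall fun y hy => ?_)
      refine LipschitzOnWith.of_dist_le_mul fun s hs' s' hs'' => ?_
      have := hK.dist_le_mul _ (Metric.ball_subset_closedBall (hmem s hs' y hy)) _
        (Metric.ball_subset_closedBall (hmem s' hs'' y hy))
      refine this.trans_eq ?_
      rw [dist_add_left, dist_eq_norm, ← sub_smul, norm_smul, Real.coe_nnabs,
        abs_of_nonneg (by positivity), dist_eq_norm]
      ring
    · exact integrableOn_const (measure_ball_lt_top (μ := μ)).ne
    · refine (ae_restrict_iff' measurableSet_ball).2 ?_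
      have := (measurePreserving_add_right μ (t • v)).quasiMeasurePreserving.ae
        (hf.ae_differentiableAt_of_mem_ball (μ := μ) x R)
      filter_upwards [this] with y hy hya
      have h1 : HasDerivAt (fun s : ℝ => y + s • v) v t := by
        simpa using ((hasDerivAt_id t).smul_const v).const_add y
      exact (hy (hmem t (hseg t ht) y hya)).hasFDerivAt.comp_hasDerivAt t h1
  have hbound : ∀ t ∈ Set.Icc (0 : ℝ) 1,
      ‖∫ y in Metric.ball a ρ, fderiv ℝ f (y + t • v) v ∂μ‖
        ≤ C * ‖v‖ * μ.real (Metric.ball a ρ) := by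
    intro t ht
    refine norm_setIntegral_le_of_norm_le_const_ae' measure_ball_lt_top ?_
    have := (measurePreserving_add_right μ (t • v)).quasiMeasurePreserving.ae h
    filter_upwards [this] with y hy hya
    exact (fderiv ℝ f (y + t • v)).le_of_opNorm_le (hy (hmem t (hseg t ht) y hya)) v
  have := Convex.norm_image_sub_le_of_norm_hasDerivWithin_le
    (fun t ht => (hderiv t ht).hasDerivWithinAt) hbound (convex_Icc 0 1)
    (Set.left_mem_Icc.2 zero_le_one) (Set.right_mem_Icc.2 zero_le_one)
  rw [← integral_sub (hint 1) (hint 0)] at this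
  simpa using this

/-- A locally Lipschitz map whose derivative is bounded by `C` almost everywhere on a ball is
`C`-Lipschitz on that ball. -/
theorem LocallyLipschitz.lipschitzOnWith_closedBall {μ : Measure E} [μ.IsAddHaarMeasure]
    {f : E → F} (hf : LocallyLipschitz f) {x : E} {R : ℝ} (hR : R ≠ 0) {C : ℝ≥0}
    (h : ∀ᵐ z ∂μ, z ∈ Metric.ball x R → ‖fderiv ℝ f z‖ ≤ C) :
    LipschitzOnWith C f (Metric.closedBall x R) := by
  have hfc : Continuous f := hf.continuous
  rw [← closure_ball x hR, lipschitzOnWith_closure_iff hfc.continuousOn]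
  refine LipschitzOnWith.of_dist_le_mul fun b hb a ha => ?_
  rw [dist_eq_norm, dist_eq_norm]
  refine le_of_forall_pos_le_add fun ε hε => ?_
  obtain ⟨r, hra, hrR⟩ := exists_between (max_lt (Metric.mem_ball.1 ha) (Metric.mem_ball.1 hb))
  obtain ⟨δ, hδ, hδε⟩ := Metric.continuousAt_iff.1
    ((by fun_prop : Continuous fun y => f (y + (b - a)) - f y).continuousAt (x := a)) ε hε
  -- `δ` keeps the increments within `ε` of `f b - f a`; `R - r` keeps the translated balls inside
  -- `ball x R`.
  set ρ := min δ (R - r)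
  have hρ : 0 < ρ := lt_min hδ (sub_pos.2 hrR)
  have h1 := hf.norm_setIntegral_sub_le h (r := r) (ρ := ρ)
    (by linarith [min_le_right δ (R - r)])
    (Metric.mem_ball.2 ((le_max_left _ _).trans_lt hra))
    (Metric.mem_ball.2 ((le_max_right _ _).trans_lt hra))
  have hint : IntegrableOn (fun y => f (y + (b - a)) - f y) (Metric.ball a ρ) μ :=
    ((by fun_prop : Continuous fun y => f (y + (b - a)) - f y).continuousOn.integrableOn_compact
      (isCompact_closedBall a ρ)).mono_set Metric.ball_subset_closedBall
  have hfin : μ (Metric.ball a ρ) < ⊤ := measure_ball_lt_top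
  have h2 : ‖∫ y in Metric.ball a ρ, ((f b - f a) - (f (y + (b - a)) - f y)) ∂μ‖
      ≤ ε * μ.real (Metric.ball a ρ) := by
    refine norm_setIntegral_le_of_norm_le_const hfin fun y hy => ?_
    have := hδε (Metric.mem_ball.1 hy |>.trans_le (min_le_left _ _))
    rw [add_sub_cancel, dist_comm, dist_eq_norm] at this
    exact this.le
  have hconst : IntegrableOn (fun _ => f b - f a) (Metric.ball a ρ) μ :=
    integrableOn_const hfin.ne
  rw [integral_sub hconst hint, setIntegral_const] at h2
  have hpos : 0 < μ.real (Metric.ball a ρ) :=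
    ENNReal.toReal_pos (Metric.measure_ball_pos μ a hρ).ne' hfin.ne
  refine le_of_mul_le_mul_right ?_ hpos
  have h3 := norm_le_norm_add_norm_sub
    (∫ y in Metric.ball a ρ, (f (y + (b - a)) - f y) ∂μ) (μ.real (Metric.ball a ρ) • (f b - f a))
  rw [norm_smul, Real.norm_of_nonneg hpos.le] at h3
  rw [norm_sub_rev] at h2
  linarith

end LipschitzOfDerivative

section Clarke

variable {E F : Type*} [NormedAddCommGroup E] [NormedSpace ℝ E] [NormedAddCommGroup F]
  [NormedSpace ℝ F]

theorem fderiv_mem_clarkeSubdifferential {S : Set E} {f : E → F} {x : E} (hx : x ∉ S)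
    (hf : DifferentiableAt ℝ f x) : fderiv ℝ f x ∈ clarkeSubdifferential S f x :=
  subset_convexHull ℝ _
    ⟨fun _ => x, tendsto_const_nhds, fun _ => ⟨hx, hf⟩, tendsto_const_nhds⟩

/-- A continuous bound on the norm of the derivative bounds the Clarke subdifferential. -/
theorem norm_le_of_mem_clarkeSubdifferential {S : Set E} {f : E → F} {c : E → ℝ}
    (hc : Continuous c) (hf : ∀ x, ‖fderiv ℝ f x‖ ≤ c x) {x : E} {ζ : E →L[ℝ] F}
    (hζ : ζ ∈ clarkeSubdifferential S f x) : ‖ζ‖ ≤ c x := by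
  have : clarkeSubdifferential S f x ⊆ Metric.closedBall 0 (c x) := by
    refine convexHull_min ?_ (convex_closedBall _ _)
    rintro L ⟨u, hu, -, hL⟩
    rw [mem_closedBall_zero_iff]
    exact le_of_tendsto_of_tendsto' hL.norm ((hc.tendsto x).comp hu) fun k => hf (u k)
  simpa using this hζ

variable [FiniteDimensional ℝ E] [MeasurableSpace E] [BorelSpace E] [FiniteDimensional ℝ F]

namespace SubgradientGrowth

variable {S : Set E} {f : E → F} {α : E → ℝ≥0} {β : E → ℝ≥0 → ℝ≥0}

omit [FiniteDimensional ℝ E] [BorelSpace E] [FiniteDimensional ℝ F] in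
theorem ae_norm_fderiv_le (hα : SubgradientGrowth S f α β) {μ : Measure E} (hS : μ S = 0) :
    ∀ᵐ z ∂μ, ‖fderiv ℝ f z‖ ≤ α z := by
  filter_upwards [measure_eq_zero_iff_ae_notMem.1 hS] with z hz
  by_cases hd : DifferentiableAt ℝ f z
  · exact hα.norm_le z _ (fderiv_mem_clarkeSubdifferential hz hd)
  -- The default value `0` of `fderiv` makes Rademacher unnecessary here.
  · simp [fderiv_zero_of_not_differentiableAt hd]

theorem exists_lipschitzOnWith (hα : SubgradientGrowth S f α β) (hf : LocallyLipschitz f)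
    {μ : Measure E} [μ.IsAddHaarMeasure] (hS : μ S = 0) {x : E} {C : ℝ≥0} (hC : α x < C) :
    ∃ s ∈ 𝓝 x, LipschitzOnWith C f s := by
  obtain ⟨R, hR, hRC⟩ := Metric.eventually_nhds_iff_ball.1
    (hα.continuous_alpha.continuousAt.eventually_lt_const hC)
  refine ⟨_, Metric.closedBall_mem_nhds x hR,
    hf.lipschitzOnWith_closedBall (μ := μ) hR.ne' ?_⟩
  filter_upwards [hα.ae_norm_fderiv_le hS] with z hz hzR
  exact hz.trans (NNReal.coe_le_coe.2 (hRC z hzR).le)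

omit [FiniteDimensional ℝ E] [MeasurableSpace E] [BorelSpace E] [FiniteDimensional ℝ F] in
theorem alpha_le (hα : SubgradientGrowth S f α β) {x y : E} {r : ℝ≥0} (hr : ‖y - x‖₊ ≤ r) :
    α y ≤ α x + β x r := by
  have h1 := (abs_le.1 (hα.abs_sub_le x y)).1
  have h2 : (β x ‖y - x‖₊ : ℝ) ≤ β x r := NNReal.coe_le_coe.2 (hα.monotone_beta x hr)
  rw [← NNReal.coe_le_coe]
  push_cast
  linarith

/-- By monotonicity of `β x`, the first factor bounds `α` on the whole ball around `x` with `y` on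
its boundary, hence is a Lipschitz constant there. -/
theorem nnnorm_sub_le (hα : SubgradientGrowth S f α β) (hf : LocallyLipschitz f)
    {μ : Measure E} [μ.IsAddHaarMeasure] (hS : μ S = 0) (x y : E) :
    ‖f y - f x‖₊ ≤ (α x + β x ‖y - x‖₊) * ‖y - x‖₊ := by
  rcases eq_or_ne y x with rfl | hxy
  · simp
  have hlip := hf.lipschitzOnWith_closedBall (μ := μ) (x := x) (R := ‖y - x‖)
    (C := α x + β x ‖y - x‖₊) (norm_ne_zero_iff.2 (sub_ne_zero.2 hxy)) <| by
      filter_upwards [hα.ae_norm_fderiv_le hS] with z hz hzR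
      exact hz.trans (NNReal.coe_le_coe.2 (hα.alpha_le (mem_ball_iff_norm.1 hzR).le))
  exact hlip.norm_sub_le (mem_closedBall_iff_norm.2 le_rfl)
    (Metric.mem_closedBall_self (norm_nonneg _))

variable {G : Type*} [NormedAddCommGroup G] [NormedSpace ℝ G] [FiniteDimensional ℝ G]
  [MeasurableSpace F] [BorelSpace F] {T : Set F} {g : F → G} {α' : F → ℝ≥0} {β' : F → ℝ≥0 → ℝ≥0}

theorem norm_fderiv_comp_le (hgα : SubgradientGrowth T g α' β') (hg : LocallyLipschitz g)
    (hα : SubgradientGrowth S f α β) (hf : LocallyLipschitz f)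
    {μ : Measure E} [μ.IsAddHaarMeasure] (hS : μ S = 0)
    {ν : Measure F} [ν.IsAddHaarMeasure] (hT : ν T = 0) (x : E) :
    ‖fderiv ℝ (g ∘ f) x‖ ≤ α x * α' (f x) := by
  -- Continuity of `α` and `α'` gives neighbourhood bounds only for constants strictly above their
  -- values at the point.
  refine le_mul_of_forall_lt₀ fun a ha b hb => ?_
  lift a to ℝ≥0 using (NNReal.coe_nonneg _).trans ha.le
  lift b to ℝ≥0 using (NNReal.coe_nonneg _).trans hb.le
  obtain ⟨s, hs, hsa⟩ := hα.exists_lipschitzOnWith hf hS (NNReal.coe_lt_coe.1 ha)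
  obtain ⟨t, ht, htb⟩ := hgα.exists_lipschitzOnWith hg hT (NNReal.coe_lt_coe.1 hb)
  rw [mul_comm, ← NNReal.coe_mul]
  exact norm_fderiv_le_of_lipschitzOn ℝ
    (inter_mem hs (hf.continuous.continuousAt.preimage_mem_nhds ht))
    (htb.comp (hsa.mono Set.inter_subset_left) fun z hz => hz.2)

/-- The subgradient growth condition of a composition. -/
theorem comp (hgα : SubgradientGrowth T g α' β') (hg : LocallyLipschitz g)
    (hα : SubgradientGrowth S f α β) (hf : LocallyLipschitz f)
    {μ : Measure E} [μ.IsAddHaarMeasure] (hS : μ S = 0)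
    {ν : Measure F} [ν.IsAddHaarMeasure] (hT : ν T = 0) (U : Set E) :
    SubgradientGrowth U (g ∘ f) (fun x => α x * α' (f x))
      (fun x r => (α x + β x r) * β' (f x) ((α x + β x r) * r) + β x r * α' (f x)) := by
  have hfc := hα.continuous_fun
  have hαc := hα.continuous_alpha
  have hβc := hα.continuous_beta
  have hα'c := hgα.continuous_alpha
  have hcα : Continuous fun x => α x * α' (f x) := by fun_prop
  refine ⟨hgα.continuous_fun.comp hfc, hcα, ?_, ?_, ?_, ?_⟩
  · have hL : Continuous fun p : E × ℝ≥0 => α p.1 + β p.1 p.2 := by fun_prop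
    have hβ'c : Continuous fun p : E × ℝ≥0 => β' (f p.1) ((α p.1 + β p.1 p.2) * p.2) :=
      hgα.continuous_beta.comp (by fun_prop :
        Continuous fun p : E × ℝ≥0 => (f p.1, (α p.1 + β p.1 p.2) * p.2))
    exact (hL.mul hβ'c).add (hβc.mul (hα'c.comp (hfc.comp continuous_fst)))
  · intro x r s hrs
    have h1 := hα.monotone_beta x hrs
    have h2 := hgα.monotone_beta (f x) (mul_le_mul' (add_le_add_right h1 (α x)) hrs)
    dsimp only
    gcongr
  · intro x ζ hζ
    exact norm_le_of_mem_clarkeSubdifferential (c := fun x => ((α x * α' (f x) : ℝ≥0) : ℝ))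
      (NNReal.continuous_coe.comp hcα)
      (fun z => by simpa using hgα.norm_fderiv_comp_le hg hα hf hS hT z) hζ
  · intro x y
    have h1 : (α y : ℝ) ≤ α x + β x ‖y - x‖₊ := by
      exact_mod_cast hα.alpha_le (x := x) (y := y) le_rfl
    have h2 : |(α' (f x) : ℝ) - α' (f y)|
        ≤ β' (f x) ((α x + β x ‖y - x‖₊) * ‖y - x‖₊) :=
      (hgα.abs_sub_le (f x) (f y)).trans
        (NNReal.coe_le_coe.2 (hgα.monotone_beta _ (hα.nnnorm_sub_le hf hS x y)))
    have h3 := hα.abs_sub_le x y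
    push_cast
    calc |(α x : ℝ) * α' (f x) - α y * α' (f y)|
        -- Weighting by `α y` leaves `α' (f x)` in the second term, as `β_f` requires; `h1` then
        -- replaces `α y`.
        = |(α y : ℝ) * (α' (f x) - α' (f y)) + (α x - α y) * α' (f x)| := by congr 1; ring
      _ ≤ α y * |(α' (f x) : ℝ) - α' (f y)| + |(α x : ℝ) - α y| * α' (f x) := by
        refine (abs_add_le _ _).trans_eq ?_
        rw [abs_mul, abs_mul, NNReal.abs_eq, NNReal.abs_eq]
      _ ≤ _ := by gcongr

end SubgradientGrowth

end Clarke

theorem mainTheorem6 (d m : ℕ)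
    (g : EuclideanSpace ℝ (Fin m) → ℝ)
    (h : EuclideanSpace ℝ (Fin d) → EuclideanSpace ℝ (Fin m))
    (hg_lip : LocallyLipschitz g) (hh_lip : LocallyLipschitz h)
    (αg : EuclideanSpace ℝ (Fin m) → ℝ≥0) (βg : EuclideanSpace ℝ (Fin m) → ℝ≥0 → ℝ≥0)
    (αh : EuclideanSpace ℝ (Fin d) → ℝ≥0) (βh : EuclideanSpace ℝ (Fin d) → ℝ≥0 → ℝ≥0)
    (Sg : Set (EuclideanSpace ℝ (Fin m))) (Sh Sf : Set (EuclideanSpace ℝ (Fin d)))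
    (hSg : volume Sg = 0) (hSh : volume Sh = 0) (hSf : volume Sf = 0)
    (hg : SubgradientGrowth Sg g αg βg) (hh : SubgradientGrowth Sh h αh βh) :
    SubgradientGrowth Sf (g ∘ h)
      (fun x => αh x * αg (h x))
      (fun x r => (αh x + βh x r) * βg (h x) ((αh x + βh x r) * r) + βh x r * αg (h x)) := by
  exact hg.comp hg_lip hh hh_lip hSh hSg Sf
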